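/- Let $\Omega$ be a measurable space whose $\sigma$-algebra is countably generated (for instance, a Borel space), and let $\mathbf P^{\mathrm I},\mathbf P^{\mathrm{II}}$ be probability measures on $\Omega^\infty$ (with the product $\sigma$-algebra), whose generic element is $\omega=\omega_1\omega_2\ldots$. For each $n\ge1$ let $P^{\mathrm I}_n$ (resp. $P^{\mathrm{II}}_n$) be a regular conditional distribution of $\omega_n$ given $\omega_1,\ldots,\omega_{n-1}$ with respect to $\mathbf P^{\mathrm I}$ (resp. $\mathbf P^{\mathrm{II}}$), i.e. a probability measure on $\Omega$ depending measurably on $(\omega_1,\ldots,\omega_{n-1})$; these are assumed to exist (as they always do when $\Omega$ is a Borel space). Let $\mathcal F_n$ be the $\sigma$-algebra on $\Omega^\infty$ generated by $\omega_1,\ldots,\omega_n$, and assume local absolute continuity: $\mathbf P^{\mathrm I}|_{\mathcal F_n}\ll\mathbf P^{\mathrm{II}}|_{\mathcal F_n}$ for all $n\ge0$. For $\alpha\in(-1,1)$ and probability measures $P,P'$ on $\Omega$ let $$D^{(\alpha)}(P\,\|\,P'):=\frac{4}{1-\alpha^2}\left(1-\int_\Omega \beta^{\frac{1-\alpha}{2}}\,(\beta')^{\frac{1+\alpha}{2}}\,dQ\right),$$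 where $Q:=(P+P')/2$ and $\beta,\beta'$ are the densities of $P,P'$ with respect to $Q$ (with $0\cdot\infty:=0$; any other probability measure $Q$ dominating $P$ and $P'$ gives the same value). This quantity is nonnegative. Then for every $\alpha\in(-1,1)$: 1. $\mathbf P^{\mathrm I}\ll\mathbf P^{\mathrm{II}}$ if and only if $\sum_{n=1}^\infty D^{(\alpha)}(P^{\mathrm I}_n\,\|\,P^{\mathrm{II}}_n)<\infty$ holds $\mathbf P^{\mathrm I}$-almost surely; 2. $\mathbf P^{\mathrm I}\perp\mathbf P^{\mathrm{II}}$ if and only if $\sum_{n=1}^\infty D^{(\alpha)}(P^{\mathrm I}_n\,\|\,P^{\mathrm{II}}_n)=\infty$ holds $\mathbf P^{\mathrm I}$-almost surely. -/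

import Mathlib

open MeasureTheory ProbabilityTheory Filter
open scoped ENNReal

noncomputable section

/-- The `α`-divergence between two finite measures, with the dominating measure
`Q := (μ + ν) / 2`. The integral is taken in `[0, ∞]`, where `0 * ∞ = 0`; for probability measures
and `-1 < α < 1` it is at most `1`, so `toReal` loses nothing. -/
def alphaDivergence {Ω : Type*} [MeasurableSpace Ω] (α : ℝ) (μ ν : Measure Ω) : ℝ :=
  let Q : Measure Ω := (2⁻¹ : ℝ≥0∞) • (μ + ν)
  4 / (1 - α ^ 2) *
    (1 - (∫⁻ x, (μ.rnDeriv Q x) ^ ((1 - α) / 2) * (ν.rnDeriv Q x) ^ ((1 + α) / 2) ∂Q).toReal)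

/-- The first `n` observations of an infinite sequence of observations. Observations are indexed
from `0`, so the coordinate `ω n` is the `(n + 1)`-st observation and `past n ω` is the list of
the observations that precede it. -/
def past {Ω : Type*} (n : ℕ) (ω : ℕ → Ω) : Fin n → Ω := fun i => ω i

theorem measurable_past {Ω : Type*} [MeasurableSpace Ω] (n : ℕ) :
    Measurable (past n : (ℕ → Ω) → (Fin n → Ω)) :=
  measurable_pi_lambda _ fun i => measurable_pi_apply (i : ℕ)

/-- The `σ`-algebra on the sequence space generated by the first `n` observations. -/
abbrev pastSigma (Ω : Type*) [MeasurableSpace Ω] (n : ℕ) : MeasurableSpace (ℕ → Ω) :=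
  MeasurableSpace.comap (past n) MeasurableSpace.pi

theorem pastSigma_le (Ω : Type*) [MeasurableSpace Ω] (n : ℕ) :
    pastSigma Ω n ≤ (MeasurableSpace.pi : MeasurableSpace (ℕ → Ω)) :=
  (measurable_past n).comap_le

/-- Local absolute continuity: the restriction of `P` to the `σ`-algebra of the first `n`
observations is absolutely continuous with respect to the restriction of `Q`, for every `n`. -/
def LocallyAbsolutelyContinuous {Ω : Type*} [MeasurableSpace Ω] (P Q : Measure (ℕ → Ω)) : Prop :=
  ∀ n : ℕ, P.trim (pastSigma_le Ω n) ≪ Q.trim (pastSigma_le Ω n)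

/-- The kernels `κ n` are regular conditional distributions, under `P`, of each observation `ω n`
given all the observations that precede it. -/
def IsRegularConditionalSystem {Ω : Type*} [MeasurableSpace Ω] (P : Measure (ℕ → Ω))
    (κ : (n : ℕ) → Kernel (Fin n → Ω) Ω) : Prop :=
  ∀ n : ℕ, IsMarkovKernel (κ n) ∧ HasCondDistrib (fun ω : ℕ → Ω => ω n) (past n) (κ n) P

end

/-! ### Finite pasts, their σ-algebras and one-step conditioning. -/

section Filtration

variable {Ω : Type*} [MeasurableSpace Ω]

/-! Put s = (1 + α)/2. Let y_n be the density of κ₂ n with respect to κ₁ n, let Y_n be the product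
of the first n factors (the likelihood ratio of P₂ to P₁), and let H_n = ∫ y_n^s dκ₁ be the
conditional moment. The divergence is 4/(1 - α²) · (1 - H_n). Local absolute continuity makes Y_n
and H_n nonzero P₁-a.s., so the series of divergences converges exactly when ∏ H_n > 0.

Under P₁ the ratio Y_n^s / ∏_{k<n} H_k has mean at most one. By Fatou its liminf is finite, so inf
Y_n = 0 wherever ∏ H_n = 0 (`ae_exists_pathProd_lt`). Where ∏ H_n ≥ ε, the suitably stopped ratio
keeps conditional mean one and is uniformly integrable by Hölder, so Y_n → 0 only on a null set
(`measure_tendsto_pathProd_zero_of_le_prod`).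

Two maximal inequalities turn this into statements on the measures: P₂ does not charge the regular
paths with inf Y_n = 0 (`measure_forall_exists_pathProd_likelihoodFactor_lt`), and on a P₂-null set
Y_n → 0 holds P₁-a.s. (`measure_inter_not_tendsto_likelihood_eq_zero`). Each of the four
implications combines one of these with the dichotomy. Convergence of Y_n is never needed: limit
events are approximated by events of a finite past. -/

theorem measurable_pastSigma_past (n : ℕ) :
    Measurable[pastSigma Ω n] (past n : (ℕ → Ω) → (Fin n → Ω)) :=
  comap_measurable _

theorem pastSigma_mono {m n : ℕ} (h : m ≤ n) : pastSigma Ω m ≤ pastSigma Ω n := by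
  have hc : (past m : (ℕ → Ω) → (Fin m → Ω)) = (fun v i => v (Fin.castLE h i)) ∘ past n := rfl
  rw [pastSigma, hc, ← MeasurableSpace.comap_comp]
  exact MeasurableSpace.comap_mono (Measurable.comap_le (by fun_prop))

theorem measurable_pastSigma_coord {k n : ℕ} (h : k < n) :
    Measurable[pastSigma Ω n] (fun ω : ℕ → Ω => ω k) :=
  (measurable_pi_apply (⟨k, h⟩ : Fin n)).comp (measurable_pastSigma_past n)

theorem measurable_pastSigma_comp {k n : ℕ} (h : k ≤ n) {β : Type*} [MeasurableSpace β]
    {f : (Fin k → Ω) → β} (hf : Measurable f) :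
    Measurable[pastSigma Ω n] (fun ω : ℕ → Ω => f (past k ω)) :=
  (hf.comp (measurable_pastSigma_past k)).mono (pastSigma_mono h) le_rfl

theorem measurable_pastSigma_uncurry {k n : ℕ} (h : k < n)
    {f : (Fin k → Ω) → Ω → ℝ≥0∞} (hf : Measurable (Function.uncurry f)) :
    Measurable[pastSigma Ω n] (fun ω : ℕ → Ω => f (past k ω) (ω k)) :=
  hf.comp (((measurable_pastSigma_past k).mono (pastSigma_mono h.le) le_rfl).prodMk
    (measurable_pastSigma_coord h))

theorem measurable_pastSigma_indicator_one {n : ℕ} {A : Set (ℕ → Ω)}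
    (hA : MeasurableSet[pastSigma Ω n] A) :
    Measurable[pastSigma Ω n] (A.indicator (1 : (ℕ → Ω) → ℝ≥0∞)) :=
  (@measurable_const _ _ _ (pastSigma Ω n) 1).indicator hA

theorem exists_eq_comp_past_succ {n : ℕ} {G : (ℕ → Ω) → ℝ≥0∞}
    (hG : Measurable[pastSigma Ω (n + 1)] G) :
    ∃ g : (Fin n → Ω) → Ω → ℝ≥0∞, Measurable (Function.uncurry g) ∧
      ∀ ω, G ω = g (past n ω) (ω n) := by
  obtain ⟨h, hm, rfl⟩ := hG.exists_eq_measurable_comp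
  refine ⟨fun v x => h (Fin.snoc (α := fun _ => Ω) v x), hm.comp ?_, fun ω => ?_⟩
  · refine measurable_pi_lambda _ fun i => ?_
    refine Fin.lastCases ?_ (fun j => ?_) i
    · simpa [Function.uncurry] using measurable_snd
    · have hj : Measurable fun c : (Fin n → Ω) × Ω => c.1 j :=
        (measurable_pi_apply j).comp measurable_fst
      simpa [Function.uncurry] using hj
  · simp only [Function.comp]
    congr 1
    ext i
    refine Fin.lastCases ?_ (fun j => ?_) i <;> simp [past]

/-- Cylinders form a ring generating the product σ-algebra. This approximation does the work of
martingale convergence below. -/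
theorem exists_pastSigma_measure_symmDiff_lt (μ : Measure (ℕ → Ω)) [IsFiniteMeasure μ]
    {N : Set (ℕ → Ω)} (hN : MeasurableSet N) {ε : ℝ≥0∞} (hε : 0 < ε) :
    ∃ m A, MeasurableSet[pastSigma Ω m] A ∧ μ (symmDiff A N) < ε := by
  obtain ⟨A, hA, hlt⟩ := exists_measure_symmDiff_lt_of_generateFrom_isSetRing (μ := μ)
    (C := measurableCylinders fun _ : ℕ => Ω) isSetRing_measurableCylinders
    ⟨{Set.univ}, by simp, Set.singleton_subset_iff.2 (univ_mem_measurableCylinders _), by simp⟩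
    generateFrom_measurableCylinders.symm hN hε
  rw [mem_measurableCylinders] at hA
  obtain ⟨s, S, hS, rfl⟩ := hA
  refine ⟨s.sup id + 1, _, ?_, hlt⟩
  have : Measurable[pastSigma Ω (s.sup id + 1)] (s.restrict : (ℕ → Ω) → (s → Ω)) :=
    @measurable_pi_lambda _ _ _ (pastSigma Ω (s.sup id + 1)) _ _ fun i =>
      measurable_pastSigma_coord (Nat.lt_succ_of_le (Finset.le_sup (f := id) i.2))
  exact this hS

theorem lintegral_mul_condDistrib {P : Measure (ℕ → Ω)} [IsFiniteMeasure P] {n : ℕ}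
    {κ : Kernel (Fin n → Ω) Ω} [IsMarkovKernel κ]
    (h : HasCondDistrib (fun ω : ℕ → Ω => ω n) (past n) κ P)
    {G : (ℕ → Ω) → ℝ≥0∞} (hG : Measurable[pastSigma Ω n] G)
    {f : (Fin n → Ω) → Ω → ℝ≥0∞} (hf : Measurable (Function.uncurry f)) :
    ∫⁻ ω, G ω * f (past n ω) (ω n) ∂P
      = ∫⁻ ω, G ω * ∫⁻ x, f (past n ω) x ∂(κ (past n ω)) ∂P := by
  obtain ⟨g, hg, rfl⟩ := hG.exists_eq_measurable_comp
  have hgf : Measurable fun p : (Fin n → Ω) × Ω => g p.1 * f p.1 p.2 :=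
    (hg.comp measurable_fst).mul hf
  calc ∫⁻ ω, (g ∘ past n) ω * f (past n ω) (ω n) ∂P
      = ∫⁻ p, g p.1 * f p.1 p.2 ∂(P.map fun ω => (past n ω, ω n)) :=
        (lintegral_map hgf ((measurable_past n).prodMk (measurable_pi_apply n))).symm
    _ = ∫⁻ v, ∫⁻ x, g v * f v x ∂(κ v) ∂(P.map (past n)) := by
        rw [h.map_eq, Measure.lintegral_compProd hgf]
    _ = ∫⁻ ω, ∫⁻ x, g (past n ω) * f (past n ω) x ∂(κ (past n ω)) ∂P :=
        lintegral_map hgf.lintegral_kernel_prod_right' (measurable_past n)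
    _ = _ := by
        refine lintegral_congr fun ω => ?_
        exact lintegral_const_mul _ (hf.comp measurable_prodMk_left)

theorem ae_notMem_of_condDistrib_eq_zero {P : Measure (ℕ → Ω)} [IsFiniteMeasure P] {n : ℕ}
    {κ : Kernel (Fin n → Ω) Ω} [IsMarkovKernel κ]
    (h : HasCondDistrib (fun ω : ℕ → Ω => ω n) (past n) κ P)
    {T : Set ((Fin n → Ω) × Ω)} (hT : MeasurableSet T) (h0 : ∀ v, κ v (Prod.mk v ⁻¹' T) = 0) :
    ∀ᵐ ω ∂P, (past n ω, ω n) ∉ T := by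
  have hmap : P.map (fun ω => (past n ω, ω n)) T = 0 := by
    rw [h.map_eq, Measure.compProd_apply hT]
    simp [h0]
  rw [Measure.map_apply ((measurable_past n).prodMk (measurable_pi_apply n)) hT] at hmap
  exact measure_eq_zero_iff_ae_notMem.1 hmap

end Filtration

/-! ### Hölder bound and Radon–Nikodym identities. -/

/-- Hölder against the constant 1 on E. This is the source of uniform integrability. -/
theorem setLIntegral_rpow_le {α : Type*} [MeasurableSpace α] {μ : Measure α} {f : α → ℝ≥0∞}
    (hf : Measurable f) (hf1 : ∫⁻ x, f x ∂μ ≤ 1) {s : ℝ} (hs : s ∈ Set.Ioo (0 : ℝ) 1)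
    (E : Set α) : ∫⁻ x in E, f x ^ s ∂μ ≤ μ E ^ (1 - s) := by
  have := ENNReal.lintegral_mul_norm_pow_le (μ := μ.restrict E) (f := f) (g := fun _ => 1)
    hf.aemeasurable aemeasurable_const hs.1.le (sub_nonneg.2 hs.2.le) (add_sub_cancel s 1)
  simp only [ENNReal.one_rpow, mul_one, lintegral_const, one_mul, Measure.restrict_apply_univ]
    at this
  refine this.trans (mul_le_of_le_one_left' (ENNReal.rpow_le_one ?_ hs.1.le))
  exact (setLIntegral_le_lintegral _ _).trans hf1

theorem kernel_lintegral_rnDeriv_mul {α γ : Type*} [MeasurableSpace α] [MeasurableSpace γ]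
    [MeasurableSpace.CountableOrCountablyGenerated α γ] (κ η : Kernel α γ) [IsFiniteKernel κ]
    [IsFiniteKernel η] (a : α) {g : γ → ℝ≥0∞} (hg : Measurable g) :
    ∫⁻ x, κ.rnDeriv η a x * g x ∂(η a)
      = ∫⁻ x, (Kernel.mutuallySingularSetSlice κ η a)ᶜ.indicator g x ∂(κ a) := by
  set S := Kernel.mutuallySingularSetSlice κ η a
  have hS : MeasurableSet S := Kernel.measurableSet_mutuallySingularSetSlice κ η a
  have hr := Kernel.measurable_rnDeriv_right κ η a
  have hw : (η a).withDensity (κ.rnDeriv η a) = (κ a).restrict Sᶜ := by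
    rw [← Kernel.withDensity_apply _ (Kernel.measurable_rnDeriv κ η)]
    ext t ht
    rw [Measure.restrict_apply ht, ← Kernel.withDensity_rnDeriv_of_subset_compl_mutuallySingularSetSlice
      (ht.inter hS.compl) Set.inter_subset_right]
    have h0 : Kernel.withDensity η (κ.rnDeriv η) a S = 0 :=
      Kernel.withDensity_rnDeriv_mutuallySingularSetSlice κ η a
    exact (measure_inter_conull' (measure_mono_null (by intro x hx; simpa using hx.2) h0)).symm
  rw [lintegral_indicator hS.compl, ← hw, lintegral_withDensity_eq_lintegral_mul _ hr hg]
  rfl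

/-- By the chain rule dν/dQ = (dν/dμ)(dμ/dQ) wherever dμ/dQ ≠ 0; the rest of the space contributes
nothing because 1 - s > 0. Hence the part of ν singular to μ is invisible to the divergence. -/
theorem lintegral_rnDeriv_rpow_mul_rpow {γ : Type*} [MeasurableSpace γ] (μ ν : Measure γ)
    [IsFiniteMeasure μ] [IsFiniteMeasure ν] {s : ℝ} (hs : s ∈ Set.Ioo (0 : ℝ) 1)
    {Q : Measure γ} [IsFiniteMeasure Q] (hμ : μ ≪ Q) :
    ∫⁻ x, (μ.rnDeriv Q x) ^ (1 - s) * (ν.rnDeriv Q x) ^ s ∂Q = ∫⁻ x, (ν.rnDeriv μ x) ^ s ∂μ := by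
  have hm := (Measure.measurable_rnDeriv ν μ).pow_const s
  rw [← lintegral_rnDeriv_mul hμ hm.aemeasurable]
  have h := Measure.rnDeriv_mul_rnDeriv' (μ := ν) hμ
  have hs' : 0 < 1 - s := sub_pos.2 hs.2
  rw [← Measure.withDensity_rnDeriv_eq μ Q hμ, EventuallyEq,
    ae_withDensity_iff (Measure.measurable_rnDeriv μ Q), Measure.withDensity_rnDeriv_eq μ Q hμ] at h
  refine lintegral_congr_ae ?_
  filter_upwards [h, Measure.rnDeriv_lt_top μ Q] with x hx hlt
  by_cases h0 : μ.rnDeriv Q x = 0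
  · simp [h0, hs']
  · rw [← hx h0, Pi.mul_apply, ENNReal.mul_rpow_of_nonneg _ _ hs.1.le, mul_left_comm,
      ← ENNReal.rpow_add _ _ h0 hlt.ne, sub_add_cancel, ENNReal.rpow_one, mul_comm]

theorem alphaDivergence_eq {γ : Type*} [MeasurableSpace γ] (μ ν : Measure γ)
    [IsFiniteMeasure μ] [IsFiniteMeasure ν] {α : ℝ} (hα : α ∈ Set.Ioo (-1 : ℝ) 1) :
    alphaDivergence α μ ν = 4 / (1 - α ^ 2) *
      (1 - (∫⁻ x, (ν.rnDeriv μ x) ^ ((1 + α) / 2) ∂μ).toReal) := by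
  have hs : (1 + α) / 2 ∈ Set.Ioo (0 : ℝ) 1 := ⟨by linarith [hα.1], by linarith [hα.2]⟩
  have hfin : IsFiniteMeasure ((2⁻¹ : ℝ≥0∞) • (μ + ν)) := Measure.smul_finite _ (by simp)
  have hμ : μ ≪ (2⁻¹ : ℝ≥0∞) • (μ + ν) := by
    refine Measure.AbsolutelyContinuous.mk fun t _ ht => ?_
    simp at ht
    exact ht.1
  rw [← lintegral_rnDeriv_rpow_mul_rpow μ ν hs hμ, alphaDivergence,
    show 1 - (1 + α) / 2 = (1 - α) / 2 by ring]

/-! ### Infinite products of factors in [0, 1]. -/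

section RealSequences

theorem tendsto_prod_zero_of_not_summable {h : ℕ → ℝ≥0∞} (h1 : ∀ n, h n ≤ 1)
    (hs : ¬ Summable fun n => 1 - (h n).toReal) :
    Tendsto (fun n => ∏ k ∈ Finset.range n, h k) atTop (nhds 0) := by
  have hle : ∀ n, (h n).toReal ≤ 1 := fun n => ENNReal.toReal_le_of_le_ofReal one_pos.le
    (by simpa using h1 n)
  have hdiv := (not_summable_iff_tendsto_nat_atTop_of_nonneg
    (f := fun n => 1 - (h n).toReal) (fun n => sub_nonneg.2 (hle n))).1 hs
  have hexp : Tendsto (fun n => ENNReal.ofReal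
      (Real.exp (-∑ k ∈ Finset.range n, (1 - (h k).toReal)))) atTop (nhds 0) := by
    simpa using ENNReal.tendsto_ofReal
      (Real.tendsto_exp_atBot.comp (tendsto_neg_atTop_atBot.comp hdiv))
  refine tendsto_of_tendsto_of_tendsto_of_le_of_le tendsto_const_nhds hexp (fun _ => zero_le)
    fun n => ?_
  have hfin : ∀ k, h k ≠ ⊤ := fun k => ne_top_of_le_ne_top ENNReal.one_ne_top (h1 k)
  rw [← ENNReal.ofReal_toReal (ENNReal.prod_ne_top fun k _ => hfin k), ENNReal.toReal_prod]
  refine ENNReal.ofReal_le_ofReal ?_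
  rw [← Finset.sum_neg_distrib, Real.exp_sum]
  refine Finset.prod_le_prod (fun k _ => ENNReal.toReal_nonneg) fun k _ => ?_
  -- Each factor satisfies h ≤ exp(-(1 - h)).
  have := Real.add_one_le_exp (-(1 - (h k).toReal))
  linarith

theorem exists_le_prod_of_summable {h : ℕ → ℝ≥0∞} (h1 : ∀ n, h n ≤ 1) (h0 : ∀ n, h n ≠ 0)
    (hs : Summable fun n => 1 - (h n).toReal) :
    ∃ ε : ℝ≥0∞, ε ≠ 0 ∧ ∀ n, ε ≤ ∏ k ∈ Finset.range n, h k := by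
  have hfin : ∀ k, h k ≠ ⊤ := fun k => ne_top_of_le_ne_top ENNReal.one_ne_top (h1 k)
  have hpos : ∀ n, 0 < (h n).toReal := fun n => ENNReal.toReal_pos (h0 n) (hfin n)
  have hs' : Summable fun n => (h n).toReal - 1 := by simpa using hs.neg
  have hlim := (Real.multipliable_one_add_of_summable hs').hasProd.tendsto_prod_nat
  have hne : ∏' n, (1 + ((h n).toReal - 1)) ≠ 0 :=
    tprod_one_add_ne_zero_of_summable (fun n => by simpa using (hpos n).ne') hs'.norm
  simp only [add_sub_cancel] at hlim hne
  have hanti : Antitone fun n => ∏ k ∈ Finset.range n, h k := fun m n hmn =>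
    Finset.prod_le_prod_of_subset_of_le_one' (Finset.range_mono hmn) fun k _ _ => h1 k
  have hnn : 0 ≤ ∏' n, (h n).toReal :=
    ge_of_tendsto' hlim fun n => Finset.prod_nonneg fun k _ => (hpos k).le
  refine ⟨ENNReal.ofReal (∏' n, (h n).toReal), by simpa using hnn.lt_of_ne hne.symm, ?_⟩
  have hlim' := ENNReal.tendsto_ofReal hlim
  refine fun n => hanti.le_of_tendsto (hlim'.congr fun n => ?_) n
  rw [← ENNReal.toReal_prod, ENNReal.ofReal_toReal (ENNReal.prod_ne_top fun k _ => hfin k)]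

/-- A factor is kept only while the running product, itself included, is still at least ε. So the
kept factors multiply to at least the last such running product. -/
theorem le_prod_ite_of_le_one {h : ℕ → ℝ≥0∞} (h1 : ∀ n, h n ≤ 1) {ε : ℝ≥0∞} (hε : ε ≤ 1)
    (m n : ℕ) :
    ε ≤ ∏ k ∈ Finset.Ico m n, if ε ≤ ∏ j ∈ Finset.range (k + 1), h j then h k else 1 := by
  induction n with
  | zero => simpa using hε
  | succ n ih =>
    rcases lt_or_ge n m with hn | hn
    · rw [Finset.Ico_eq_empty_of_le hn]
      simpa using hε
    · by_cases hb : ε ≤ ∏ j ∈ Finset.range (n + 1), h j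
      · refine hb.trans ((Finset.prod_le_prod_of_subset_of_le_one' (s := Finset.Ico m (n + 1))
          (by intro k; simp) fun k _ _ => h1 k).trans ?_)
        refine Finset.prod_le_prod' fun k _ => ?_
        split_ifs
        exacts [le_rfl, h1 k]
      · rw [Finset.prod_Ico_succ_top hn, if_neg hb, mul_one]
        exact ih

end RealSequences

/-! ### Multiplicative supermartingales and their conditional moments. -/

section Supermartingale

variable {Ω : Type*}

/-- The product of the factors `y k`, evaluated at the `k`-th observation and its past, over
`m ≤ k < n`. -/
noncomputable def pathProd (y : (n : ℕ) → (Fin n → Ω) → Ω → ℝ≥0∞) (m n : ℕ) (ω : ℕ → Ω) : ℝ≥0∞ :=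
  ∏ k ∈ Finset.Ico m n, y k (past k ω) (ω k)

variable {y : (n : ℕ) → (Fin n → Ω) → Ω → ℝ≥0∞}

theorem pathProd_succ {m n : ℕ} (h : m ≤ n) (ω : ℕ → Ω) :
    pathProd y m (n + 1) ω = pathProd y m n ω * y n (past n ω) (ω n) :=
  Finset.prod_Ico_succ_top h _

theorem pathProd_mul_pathProd {m n : ℕ} (h : m ≤ n) (ω : ℕ → Ω) :
    pathProd y 0 m ω * pathProd y m n ω = pathProd y 0 n ω :=
  Finset.prod_Ico_consecutive _ (Nat.zero_le m) h

theorem tendsto_pathProd_zero_of_tendsto {ω : ℕ → Ω} (h0 : ∀ n, pathProd y 0 n ω ≠ 0)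
    (hlim : Tendsto (fun n => pathProd y 0 n ω) atTop (nhds 0)) (m : ℕ) :
    Tendsto (fun n => pathProd y m n ω) atTop (nhds 0) := by
  -- The initial product may be infinite; capping it at 1 gives a divisor that is finite and
  -- nonzero.
  set c := min (pathProd y 0 m ω) 1
  have hc0 : c ≠ 0 := (lt_min (pos_iff_ne_zero.2 (h0 m)) one_pos).ne'
  have hctop : c ≠ ⊤ := ne_top_of_le_ne_top ENNReal.one_ne_top (min_le_right _ _)
  have hl : Tendsto (fun n => c⁻¹ * pathProd y 0 n ω) atTop (nhds 0) := by
    simpa using ENNReal.Tendsto.const_mul hlim (Or.inr (ENNReal.inv_ne_top.2 hc0))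
  refine tendsto_of_tendsto_of_tendsto_of_le_of_le' tendsto_const_nhds hl
    (.of_forall fun _ => zero_le) ((eventually_ge_atTop m).mono fun n hn => ?_)
  rw [← ENNReal.mul_le_iff_le_inv hc0 hctop, ← pathProd_mul_pathProd hn]
  exact mul_le_mul_left (min_le_left _ _) _

variable [MeasurableSpace Ω]

theorem measurable_pastSigma_pathProd (hy : ∀ n, Measurable (Function.uncurry (y n))) (m n : ℕ) :
    Measurable[pastSigma Ω n] (pathProd y m n) :=
  Finset.measurable_prod _ fun k hk =>
    measurable_pastSigma_uncurry (Finset.mem_Ico.1 hk).2 (hy k)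

theorem measurable_pathProd (hy : ∀ n, Measurable (Function.uncurry (y n))) (m n : ℕ) :
    Measurable (pathProd y m n) :=
  (measurable_pastSigma_pathProd hy m n).mono (pastSigma_le Ω n) le_rfl

variable {P : Measure (ℕ → Ω)} [IsProbabilityMeasure P] {κ : (n : ℕ) → Kernel (Fin n → Ω) Ω}

theorem setLIntegral_pathProd_succ (hκ : IsRegularConditionalSystem P κ)
    (hy : ∀ n, Measurable (Function.uncurry (y n))) {m n : ℕ} (hmn : m ≤ n) {A : Set (ℕ → Ω)}
    (hA : MeasurableSet[pastSigma Ω n] A) :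
    ∫⁻ ω in A, pathProd y m (n + 1) ω ∂P =
      ∫⁻ ω in A, pathProd y m n ω * ∫⁻ x, y n (past n ω) x ∂(κ n (past n ω)) ∂P := by
  have := (hκ n).1
  have hA' := pastSigma_le Ω n _ hA
  have h := lintegral_mul_condDistrib (hκ n).2
    ((measurable_pastSigma_pathProd hy m n).indicator hA) (hy n)
  rw [← lintegral_indicator hA', ← lintegral_indicator hA']
  convert h using 2 with ω ω <;> funext ω <;> by_cases hω : ω ∈ A <;> simp [hω, pathProd_succ hmn]

theorem setLIntegral_pathProd_le (hκ : IsRegularConditionalSystem P κ)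
    (hy : ∀ n, Measurable (Function.uncurry (y n))) (hy1 : ∀ n v, ∫⁻ x, y n v x ∂(κ n v) ≤ 1)
    {m n : ℕ} (hmn : m ≤ n) {A : Set (ℕ → Ω)} (hA : MeasurableSet[pastSigma Ω m] A) :
    ∫⁻ ω in A, pathProd y m n ω ∂P ≤ P A := by
  induction n, hmn using Nat.le_induction with
  | base => simp [pathProd]
  | succ n hmn ih =>
    rw [setLIntegral_pathProd_succ hκ hy hmn (pastSigma_mono hmn _ hA)]
    exact (lintegral_mono fun ω => mul_le_of_le_one_right' (hy1 n _)).trans ih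

theorem le_setLIntegral_pathProd (hκ : IsRegularConditionalSystem P κ)
    (hy : ∀ n, Measurable (Function.uncurry (y n))) (hy1 : ∀ n v, 1 ≤ ∫⁻ x, y n v x ∂(κ n v))
    {m n : ℕ} (hmn : m ≤ n) {A : Set (ℕ → Ω)} (hA : MeasurableSet[pastSigma Ω m] A) :
    P A ≤ ∫⁻ ω in A, pathProd y m n ω ∂P := by
  induction n, hmn using Nat.le_induction with
  | base => simp [pathProd]
  | succ n hmn ih =>
    rw [setLIntegral_pathProd_succ hκ hy hmn (pastSigma_mono hmn _ hA)]
    exact ih.trans (lintegral_mono fun ω => le_mul_of_one_le_right' (hy1 n _))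

/-- The conditional `s`-th moment of the factor `y n` given the past. -/
noncomputable def condMoment (κ : (n : ℕ) → Kernel (Fin n → Ω) Ω) (y : (n : ℕ) → (Fin n → Ω) → Ω → ℝ≥0∞)
    (s : ℝ) (n : ℕ) (v : Fin n → Ω) : ℝ≥0∞ :=
  ∫⁻ x, y n v x ^ s ∂(κ n v)

theorem measurable_condMoment [∀ n, IsMarkovKernel (κ n)]
    (hy : ∀ n, Measurable (Function.uncurry (y n))) (s : ℝ) (n : ℕ) :
    Measurable (condMoment κ y s n) :=
  Measurable.lintegral_kernel_prod_right' (f := fun p => y n p.1 p.2 ^ s) ((hy n).pow_const s)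

theorem condMoment_le_one [∀ n, IsMarkovKernel (κ n)]
    (hy : ∀ n, Measurable (Function.uncurry (y n))) (hy1 : ∀ n v, ∫⁻ x, y n v x ∂(κ n v) ≤ 1)
    {s : ℝ} (hs : s ∈ Set.Ioo (0 : ℝ) 1) (n : ℕ) (v : Fin n → Ω) : condMoment κ y s n v ≤ 1 := by
  have := setLIntegral_rpow_le ((hy n).comp measurable_prodMk_left) (hy1 n v) hs Set.univ
  simpa [condMoment] using this

/-- The factors y^s / H have conditional mean at most one, so by Fatou their product has a.s. finite
liminf. Multiplying back by ∏ H → 0 makes the product of the y^s small infinitely often. -/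
theorem ae_exists_pathProd_lt (hκ : IsRegularConditionalSystem P κ)
    (hy : ∀ n, Measurable (Function.uncurry (y n))) (hy1 : ∀ n v, ∫⁻ x, y n v x ∂(κ n v) ≤ 1)
    {s : ℝ} (hs : s ∈ Set.Ioo (0 : ℝ) 1) :
    ∀ᵐ ω ∂P, (∀ n, condMoment κ y s n (past n ω) ≠ 0) →
      Tendsto (fun n => ∏ k ∈ Finset.range n, condMoment κ y s k (past k ω)) atTop (nhds 0) →
      ∀ δ : ℝ≥0∞, δ ≠ 0 → ∃ n, pathProd y 0 n ω < δ := by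
  have hmk : ∀ n, IsMarkovKernel (κ n) := fun n => (hκ n).1
  set H := condMoment κ y s with hH
  have hHm : ∀ n, Measurable (H n) := measurable_condMoment hy s
  have hH1 : ∀ n v, H n v ≤ 1 := condMoment_le_one hy hy1 hs
  set g : (n : ℕ) → (Fin n → Ω) → Ω → ℝ≥0∞ := fun n v x => y n v x ^ s * (H n v)⁻¹ with hg
  have hgm : ∀ n, Measurable (Function.uncurry (g n)) := fun n =>
    ((hy n).pow_const s).mul ((hHm n).comp measurable_fst).inv
  have hg1 : ∀ n v, ∫⁻ x, g n v x ∂(κ n v) ≤ 1 := fun n v => by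
    have hm : Measurable fun x => y n v x ^ s := ((hy n).comp measurable_prodMk_left).pow_const s
    simp only [hg]
    rw [lintegral_mul_const _ hm]
    exact ENNReal.mul_inv_le_one _
  have hM : ∀ n, ∫⁻ ω, pathProd g 0 n ω ∂P ≤ 1 := fun n => by
    simpa using setLIntegral_pathProd_le hκ hgm hg1 (Nat.zero_le n) (A := Set.univ) .univ
  have hfat : ∫⁻ ω, liminf (fun n => pathProd g 0 n ω) atTop ∂P ≤ 1 :=
    (lintegral_liminf_le (measurable_pathProd hgm 0)).trans
      ((liminf_le_liminf (.of_forall hM)).trans (by simp))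
  filter_upwards [ae_lt_top (.liminf (measurable_pathProd hgm 0))
    (ne_top_of_le_ne_top ENNReal.one_ne_top hfat)] with ω hω h0 hlim δ hδ
  obtain ⟨c, hc, hctop⟩ := exists_between hω
  have hfreq := frequently_lt_of_liminf_lt (by isBoundedDefault) hc
  have hcl : Tendsto (fun n => c * ∏ k ∈ Finset.range n, H k (past k ω)) atTop (nhds 0) := by
    simpa using ENNReal.Tendsto.const_mul hlim (Or.inr hctop.ne)
  have hδs : 0 < δ ^ s := ENNReal.rpow_pos_of_nonneg (pos_iff_ne_zero.2 hδ) hs.1.le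
  obtain ⟨n, hn1, hn2⟩ := (hfreq.and_eventually (hcl.eventually (gt_mem_nhds hδs))).exists
  refine ⟨n, (ENNReal.rpow_lt_rpow_iff hs.1).1 (lt_of_le_of_lt ?_ hn2)⟩
  have : pathProd y 0 n ω ^ s = pathProd g 0 n ω * ∏ k ∈ Finset.range n, H k (past k ω) := by
    simp only [pathProd, ← Finset.range_eq_Ico, hg, ← Finset.prod_mul_distrib]
    rw [← ENNReal.prod_rpow_of_nonneg hs.1.le]
    refine Finset.prod_congr rfl fun k _ => ?_
    rw [mul_assoc, ENNReal.inv_mul_cancel (h0 k)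
      (ne_top_of_le_ne_top ENNReal.one_ne_top (hH1 _ _)), mul_one]
  rw [this]
  gcongr

/-- A uniformly integrable product of conditional mean one cannot vanish in the limit on a set of
positive measure. Uniform integrability is obtained by stopping before ∏ H drops below ε. -/
theorem measure_tendsto_pathProd_zero_of_le_prod (hκ : IsRegularConditionalSystem P κ)
    (hy : ∀ n, Measurable (Function.uncurry (y n))) (hy1 : ∀ n v, ∫⁻ x, y n v x ∂(κ n v) ≤ 1)
    {s : ℝ} (hs : s ∈ Set.Ioo (0 : ℝ) 1) {ε : ℝ≥0∞} (hε : ε ≠ 0) (hε1 : ε ≤ 1) :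
    P {ω | (∀ n, ε ≤ ∏ k ∈ Finset.range n, condMoment κ y s k (past k ω)) ∧
      (∀ n, pathProd y 0 n ω ≠ 0) ∧
      Tendsto (fun n => pathProd y 0 n ω) atTop (nhds 0)} = 0 := by
  have hmk : ∀ n, IsMarkovKernel (κ n) := fun n => (hκ n).1
  set H := condMoment κ y s with hH
  have hHm : ∀ n, Measurable (H n) := measurable_condMoment hy s
  have hH1 : ∀ n v, H n v ≤ 1 := condMoment_le_one hy hy1 hs
  set N := {ω : ℕ → Ω | (∀ n, ε ≤ ∏ k ∈ Finset.range n, H k (past k ω)) ∧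
      (∀ n, pathProd y 0 n ω ≠ 0) ∧ Tendsto (fun n => pathProd y 0 n ω) atTop (nhds 0)} with hN
  have hNm : MeasurableSet N := by
    have h1 : MeasurableSet (⋂ n, {ω : ℕ → Ω | ε ≤ ∏ k ∈ Finset.range n, H k (past k ω)}) :=
      .iInter fun n => measurableSet_le measurable_const
        (Finset.measurable_prod _ fun k _ => (hHm k).comp (measurable_past k))
    have h2 : MeasurableSet (⋂ n, {ω : ℕ → Ω | pathProd y 0 n ω = 0}ᶜ) :=
      .iInter fun n => (measurable_pathProd hy 0 n (measurableSet_singleton 0)).compl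
    have h3 := measurableSet_tendsto (l := atTop) (nhds 0) (measurable_pathProd hy 0)
    convert h1.inter (h2.inter h3)
    ext ω
    simp [hN]
  -- The product includes H n, which already depends on the first n observations only, so the
  -- stopping rule is predictable.
  set b : (n : ℕ) → Set (Fin n → Ω) := fun n =>
    {v | ε ≤ ∏ j : Fin (n + 1), H j fun i => v (Fin.castLE (Nat.lt_succ_iff.1 j.2) i)} with hb
  have hbm : ∀ n, MeasurableSet (b n) := fun n => measurableSet_le measurable_const
    (Finset.measurable_prod _ fun j _ => (hHm j).comp (by fun_prop))
  have hbpast : ∀ n ω, past n ω ∈ b n ↔ ε ≤ ∏ k ∈ Finset.range (n + 1), H k (past k ω) := by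
    intro n ω
    rw [Finset.prod_range]
    rfl
  classical
  set r : (n : ℕ) → (Fin n → Ω) → ℝ≥0∞ := fun n v => if v ∈ b n then H n v else 1 with hr
  set z : (n : ℕ) → (Fin n → Ω) → Ω → ℝ≥0∞ := fun n v x => if v ∈ b n then y n v x else 1 with hz
  set g : (n : ℕ) → (Fin n → Ω) → Ω → ℝ≥0∞ := fun n v x => z n v x ^ s * (r n v)⁻¹ with hg
  have hrm : ∀ n, Measurable (r n) := fun n => (hHm n).ite (hbm n) measurable_const
  have hzm : ∀ n, Measurable (Function.uncurry (z n)) := fun n =>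
    (hy n).ite ((hbm n).preimage measurable_fst) measurable_const
  have hgm : ∀ n, Measurable (Function.uncurry (g n)) := fun n =>
    ((hzm n).pow_const s).mul ((hrm n).comp measurable_fst).inv
  have hr0 : ∀ n v, r n v ≠ 0 := by
    intro n v
    simp only [hr]
    split_ifs with hv
    · have : ε ≤ ∏ j : Fin (n + 1), H j fun i => v (Fin.castLE (Nat.lt_succ_iff.1 j.2) i) := hv
      rw [Fin.prod_univ_castSucc] at this
      intro h0
      have h0' : H n (fun i => v (Fin.castLE le_rfl i)) = 0 := h0
      simp only [Fin.val_last] at this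
      rw [h0', mul_zero] at this
      exact hε (le_antisymm this zero_le)
    · exact one_ne_zero
  have hr1 : ∀ n v, r n v ≤ 1 := by
    intro n v
    simp only [hr]
    split_ifs
    exacts [hH1 _ _, le_rfl]
  have hrtop : ∀ n v, r n v ≠ ⊤ := fun n v => ne_top_of_le_ne_top ENNReal.one_ne_top (hr1 n v)
  have hz1 : ∀ n v, ∫⁻ x, z n v x ∂(κ n v) ≤ 1 := by
    intro n v
    by_cases hv : v ∈ b n
    · simpa [hz, hv] using hy1 n v
    · simp [hz, hv]
  have hg1 : ∀ n v, 1 ≤ ∫⁻ x, g n v x ∂(κ n v) := by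
    intro n v
    have hm : Measurable fun x => z n v x ^ s := ((hzm n).comp measurable_prodMk_left).pow_const s
    simp only [hg]
    rw [lintegral_mul_const _ hm]
    have : ∫⁻ x, z n v x ^ s ∂(κ n v) = r n v := by
      by_cases hv : v ∈ b n
      · simp [hz, hr, hv, hH, condMoment]
      · simp [hz, hr, hv]
    rw [this, ENNReal.mul_inv_cancel (hr0 n v) (hrtop n v)]
  have hgz : ∀ m n ω, pathProd g m n ω ≤ ε⁻¹ * pathProd z m n ω ^ s := by
    intro m n ω
    have h1 : pathProd g m n ω
        = pathProd z m n ω ^ s * (∏ k ∈ Finset.Ico m n, r k (past k ω))⁻¹ := by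
      rw [ENNReal.prod_inv_distrib fun i _ j _ _ => Or.inl (hr0 _ _)]
      simp only [pathProd, hg, Finset.prod_mul_distrib, ENNReal.prod_rpow_of_nonneg hs.1.le]
    rw [h1, mul_comm]
    refine mul_le_mul_left (ENNReal.inv_le_inv.2 ?_) _
    refine (le_prod_ite_of_le_one (h := fun k => H k (past k ω)) (fun k => hH1 _ _) hε1 m n).trans
      (le_of_eq (Finset.prod_congr rfl fun k _ => ?_))
    simp only [hr, hbpast]
  -- Uniform integrability: the bound does not depend on m or n.
  have hgE : ∀ m n (E : Set (ℕ → Ω)), m ≤ n →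
      ∫⁻ ω in E, pathProd g m n ω ∂P ≤ ε⁻¹ * P E ^ (1 - s) := by
    intro m n E hmn
    have hzle : ∫⁻ ω, pathProd z m n ω ∂P ≤ 1 := by
      simpa using setLIntegral_pathProd_le hκ hzm hz1 hmn (A := Set.univ) .univ
    calc ∫⁻ ω in E, pathProd g m n ω ∂P
        ≤ ∫⁻ ω in E, ε⁻¹ * pathProd z m n ω ^ s ∂P := lintegral_mono fun ω => hgz m n ω
      _ = ε⁻¹ * ∫⁻ ω in E, pathProd z m n ω ^ s ∂P :=
          lintegral_const_mul _ ((measurable_pathProd hzm m n).pow_const s)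
      _ ≤ _ := mul_le_mul_right
          (setLIntegral_rpow_le (measurable_pathProd hzm m n) hzle hs E) _
  have hglim : ∀ ω ∈ N, ∀ m, Tendsto (fun n => pathProd g m n ω) atTop (nhds 0) := by
    intro ω hω m
    have hzy : ∀ n, pathProd z m n ω = pathProd y m n ω := fun n =>
      Finset.prod_congr rfl fun k _ => if_pos ((hbpast k ω).2 (hω.1 (k + 1)))
    have hl := tendsto_pathProd_zero_of_tendsto hω.2.1 hω.2.2 m
    have hl' : Tendsto (fun n => ε⁻¹ * pathProd z m n ω ^ s) atTop (nhds 0) := by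
      simp only [hzy]
      have := ENNReal.Tendsto.const_mul (hl.ennrpow_const s) (Or.inr (ENNReal.inv_ne_top.2 hε))
      simpa [ENNReal.zero_rpow_of_pos hs.1] using this
    exact tendsto_of_tendsto_of_tendsto_of_le_of_le tendsto_const_nhds hl'
      (fun _ => zero_le) fun n => hgz m n ω
  -- Take A in a finite past m with A close to N. Starting the product at m gives P A ≤ ∫_A g, while
  -- g ≤ η on A off a set E of measure at most 2η. One η bounds the integral where g ≤ η, the other
  -- bounds the part of N outside A.
  have key : ∀ η : ℝ≥0∞, 0 < η → P N ≤ 2 * η + ε⁻¹ * (2 * η) ^ (1 - s) := by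
    intro η hη
    obtain ⟨m, A, hA, hAN⟩ := exists_pastSigma_measure_symmDiff_lt P hNm hη
    have hA' := pastSigma_le Ω m _ hA
    set B : ℕ → Set (ℕ → Ω) := fun n => N ∩ {ω | η < pathProd g m n ω} with hB
    have hBm : ∀ n, MeasurableSet (B n) := fun n =>
      hNm.inter (measurableSet_lt measurable_const (measurable_pathProd hgm m n))
    have hBlim : Tendsto (fun n => P (B n)) atTop (nhds 0) := by
      rw [← measure_empty (μ := P)]
      refine tendsto_measure_of_tendsto_indicator_of_isFiniteMeasure atTop P hBm ?_
      intro ω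
      by_cases hω : ω ∈ N
      · filter_upwards [(hglim ω hω m).eventually (gt_mem_nhds hη)] with n hn
        simp [hB, hn.le]
      · simp [hB, hω]
    obtain ⟨n, hnB, hmn⟩ := ((hBlim.eventually (gt_mem_nhds hη)).and (eventually_ge_atTop m)).exists
    set E := A \ N ∪ B n with hE
    have hEle : P E ≤ 2 * η := by
      refine (measure_union_le _ _).trans ?_
      rw [two_mul]
      exact add_le_add ((measure_mono fun ω h => Or.inl h).trans hAN.le) hnB.le
    have hcover : A ⊆ {ω | pathProd g m n ω ≤ η} ∪ E := by
      intro ω hω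
      by_cases h1 : pathProd g m n ω ≤ η
      · exact Or.inl h1
      · by_cases h2 : ω ∈ N
        · exact Or.inr (Or.inr ⟨h2, not_le.1 h1⟩)
        · exact Or.inr (Or.inl ⟨hω, h2⟩)
    have hPA : P A ≤ η + ε⁻¹ * (2 * η) ^ (1 - s) := by
      calc P A ≤ ∫⁻ ω in A, pathProd g m n ω ∂P := le_setLIntegral_pathProd hκ hgm hg1 hmn hA
        _ ≤ ∫⁻ ω in {ω | pathProd g m n ω ≤ η} ∪ E, pathProd g m n ω ∂P :=
            lintegral_mono_set hcover
        _ ≤ ∫⁻ ω in {ω | pathProd g m n ω ≤ η}, pathProd g m n ω ∂P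
              + ∫⁻ ω in E, pathProd g m n ω ∂P := lintegral_union_le _ _ _
        _ ≤ η + ε⁻¹ * (2 * η) ^ (1 - s) := by
            refine add_le_add ?_ ((hgE m n E hmn).trans ?_)
            · have hle : ∫⁻ ω in {ω | pathProd g m n ω ≤ η}, pathProd g m n ω ∂P
                  ≤ ∫⁻ _ in {ω | pathProd g m n ω ≤ η}, η ∂P :=
                setLIntegral_mono measurable_const fun ω hω => hω
              refine hle.trans ?_
              rw [setLIntegral_const]
              exact mul_le_of_le_one_right' prob_le_one
            · gcongr
              linarith [hs.2]
    calc P N ≤ P (A ∪ symmDiff A N) := measure_mono fun ω hω => by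
            by_cases h : ω ∈ A
            · exact Or.inl h
            · exact Or.inr (Or.inr ⟨hω, h⟩)
      _ ≤ P A + P (symmDiff A N) := measure_union_le _ _
      _ ≤ (η + ε⁻¹ * (2 * η) ^ (1 - s)) + η := add_le_add hPA hAN.le
      _ = _ := by ring
  have hlim : Tendsto (fun n : ℕ => 2 * (n : ℝ≥0∞)⁻¹ + ε⁻¹ * (2 * (n : ℝ≥0∞)⁻¹) ^ (1 - s))
      atTop (nhds 0) := by
    have h2 : Tendsto (fun n : ℕ => 2 * (n : ℝ≥0∞)⁻¹) atTop (nhds 0) := by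
      simpa using ENNReal.Tendsto.const_mul ENNReal.tendsto_inv_nat_nhds_zero
        (Or.inr (ENNReal.ofNat_ne_top (n := 2)))
    have h3 := ENNReal.Tendsto.const_mul (h2.ennrpow_const (1 - s))
      (Or.inr (ENNReal.inv_ne_top.2 hε))
    simpa [ENNReal.zero_rpow_of_pos (sub_pos.2 hs.2)] using h2.add h3
  exact le_antisymm (ge_of_tendsto' hlim fun n => key _ (by simp)) zero_le

end Supermartingale

/-! ### Likelihood ratio of the two systems. -/

section Comparison

variable {Ω : Type*} [MeasurableSpace Ω]

/-- Maximal inequality: split the union by the first n at which E n occurs. That event belongs to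
the n-th past, so the hypothesis applies to each piece. -/
theorem measure_inter_iUnion_le_of_forall_pastSigma {μ ν : Measure (ℕ → Ω)}
    {E : ℕ → Set (ℕ → Ω)} (hE : ∀ n, MeasurableSet[pastSigma Ω n] (E n)) {C : Set (ℕ → Ω)}
    {δ : ℝ≥0∞} (h : ∀ n A, MeasurableSet[pastSigma Ω n] A → A ⊆ E n → ν (C ∩ A) ≤ δ * μ A) :
    ν (C ∩ ⋃ n, E n) ≤ δ * μ (⋃ n, E n) := by
  have hD : ∀ n, MeasurableSet[pastSigma Ω n] (disjointed E n) := fun n => by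
    rw [disjointed_eq_inter_compl]
    exact (hE n).inter (.biInter (Set.to_countable _) fun k hk =>
      (pastSigma_mono (le_of_lt hk) _ (hE k)).compl)
  rw [← iUnion_disjointed (f := E), Set.inter_iUnion,
    measure_iUnion (disjoint_disjointed E) fun n => pastSigma_le Ω n _ (hD n),
    ← ENNReal.tsum_mul_left]
  exact (measure_iUnion_le _).trans
    (ENNReal.tsum_le_tsum fun n => h n _ (hD n) (disjointed_subset E n))

variable [MeasurableSpace.CountablyGenerated Ω]

/-- The paths along which none of the first `n` observations falls into the part of the space
where `κ₂` is singular with respect to `κ₁`. -/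
def regularPaths (κ₁ κ₂ : (n : ℕ) → Kernel (Fin n → Ω) Ω) (n : ℕ) : Set (ℕ → Ω) :=
  {ω | ∀ k < n, ω k ∉ Kernel.mutuallySingularSetSlice (κ₂ k) (κ₁ k) (past k ω)}

/-- The factors of the likelihood ratio of the second system with respect to the first. -/
noncomputable def likelihoodFactor (κ₁ κ₂ : (n : ℕ) → Kernel (Fin n → Ω) Ω) (n : ℕ) :
    (Fin n → Ω) → Ω → ℝ≥0∞ :=
  (κ₂ n).rnDeriv (κ₁ n)

variable {P₁ P₂ : Measure (ℕ → Ω)} [IsProbabilityMeasure P₁] [IsProbabilityMeasure P₂]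
  {κ₁ κ₂ : (n : ℕ) → Kernel (Fin n → Ω) Ω}

theorem measurable_likelihoodFactor (n : ℕ) :
    Measurable (Function.uncurry (likelihoodFactor κ₁ κ₂ n)) :=
  Kernel.measurable_rnDeriv _ _

theorem lintegral_likelihoodFactor_le [∀ n, IsMarkovKernel (κ₁ n)] [∀ n, IsMarkovKernel (κ₂ n)]
    (n : ℕ) (v : Fin n → Ω) : ∫⁻ x, likelihoodFactor κ₁ κ₂ n v x ∂(κ₁ n v) ≤ 1 := by
  have := Kernel.setLIntegral_rnDeriv_le (κ := κ₂ n) (η := κ₁ n) (a := v) (s := Set.univ)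
  simpa [likelihoodFactor] using this

theorem measurableSet_regularPaths (n : ℕ) :
    MeasurableSet[pastSigma Ω n] (regularPaths κ₁ κ₂ n) := by
  have h : regularPaths κ₁ κ₂ n = ⋂ k, ⋂ (_ : k < n),
      (fun ω : ℕ → Ω => (past k ω, ω k)) ⁻¹' (Kernel.mutuallySingularSet (κ₂ k) (κ₁ k))ᶜ := by
    ext ω
    simp [regularPaths, Kernel.mutuallySingularSetSlice, Kernel.mutuallySingularSet]
  rw [h]
  refine .iInter fun k => .iInter fun hk => ?_
  have hm : Measurable[pastSigma Ω n] fun ω : ℕ → Ω => (past k ω, ω k) :=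
    ((measurable_pastSigma_past k).mono (pastSigma_mono hk.le) le_rfl).prodMk
      (measurable_pastSigma_coord hk)
  exact hm (Kernel.measurableSet_mutuallySingularSet _ _).compl

theorem regularPaths_succ (n : ℕ) : regularPaths κ₁ κ₂ (n + 1) = regularPaths κ₁ κ₂ n ∩
    {ω | ω n ∈ (Kernel.mutuallySingularSetSlice (κ₂ n) (κ₁ n) (past n ω))ᶜ} := by
  ext ω
  simp only [regularPaths, Set.mem_inter_iff, Set.mem_ofPred_eq, Nat.lt_succ_iff_lt_or_eq,
    Set.mem_compl_iff]
  exact ⟨fun h => ⟨fun k hk => h k (Or.inl hk), h n (Or.inr rfl)⟩,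
    fun h k hk => hk.elim (h.1 k) fun e => e ▸ h.2⟩

theorem ae_mem_regularPaths (hκ₁ : IsRegularConditionalSystem P₁ κ₁)
    [∀ n, IsMarkovKernel (κ₂ n)] : ∀ᵐ ω ∂P₁, ∀ n, ω ∈ regularPaths κ₁ κ₂ n := by
  have hmk : ∀ n, IsMarkovKernel (κ₁ n) := fun n => (hκ₁ n).1
  have h : ∀ k, ∀ᵐ ω ∂P₁,
      ω k ∉ Kernel.mutuallySingularSetSlice (κ₂ k) (κ₁ k) (past k ω) := fun k =>
    ae_notMem_of_condDistrib_eq_zero (hκ₁ k).2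
      (Kernel.measurableSet_mutuallySingularSet (κ₂ k) (κ₁ k))
      (Kernel.measure_mutuallySingularSetSlice (κ₂ k) (κ₁ k))
  filter_upwards [ae_all_iff.2 h] with ω hω n k _ using hω k

/-- Lebesgue decomposition on the n-th past: Y_n P₁ is P₂ restricted to the regular paths. Test
functions, rather than sets, let the induction run: integrating out the last observation leaves a
function of the past. -/
theorem lintegral_pathProd_likelihoodFactor_mul (hκ₁ : IsRegularConditionalSystem P₁ κ₁)
    (hκ₂ : IsRegularConditionalSystem P₂ κ₂) (n : ℕ) {G : (ℕ → Ω) → ℝ≥0∞}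
    (hG : Measurable[pastSigma Ω n] G) :
    ∫⁻ ω, pathProd (likelihoodFactor κ₁ κ₂) 0 n ω * G ω ∂P₁ =
      ∫⁻ ω, (regularPaths κ₁ κ₂ n).indicator G ω ∂P₂ := by
  have hmk₁ : ∀ n, IsMarkovKernel (κ₁ n) := fun n => (hκ₁ n).1
  have hmk₂ : ∀ n, IsMarkovKernel (κ₂ n) := fun n => (hκ₂ n).1
  induction n generalizing G with
  | zero =>
    obtain ⟨g, -, rfl⟩ := hG.exists_eq_measurable_comp
    have hc : ∀ ω : ℕ → Ω, past 0 ω = Fin.elim0 := fun ω => Subsingleton.elim _ _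
    simp [pathProd, regularPaths, Function.comp_def, hc]
  | succ n ih =>
    obtain ⟨g, hg, hgG⟩ := exists_eq_comp_past_succ hG
    have hS := (Kernel.measurableSet_mutuallySingularSet (κ₂ n) (κ₁ n)).compl
    set k : (Fin n → Ω) → Ω → ℝ≥0∞ := fun v =>
      (Kernel.mutuallySingularSetSlice (κ₂ n) (κ₁ n) v)ᶜ.indicator (g v) with hk
    have hkm : Measurable (Function.uncurry k) := hg.indicator hS
    have hy : ∀ m, Measurable (Function.uncurry (likelihoodFactor κ₁ κ₂ m)) :=
      measurable_likelihoodFactor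
    have hI : Measurable fun v => ∫⁻ x, k v x ∂(κ₂ n v) := hkm.lintegral_kernel_prod_right'
    calc ∫⁻ ω, pathProd (likelihoodFactor κ₁ κ₂) 0 (n + 1) ω * G ω ∂P₁
        = ∫⁻ ω, pathProd (likelihoodFactor κ₁ κ₂) 0 n ω
            * (likelihoodFactor κ₁ κ₂ n (past n ω) (ω n) * g (past n ω) (ω n)) ∂P₁ := by
          simp only [pathProd_succ (Nat.zero_le n), hgG, mul_assoc]
      _ = ∫⁻ ω, pathProd (likelihoodFactor κ₁ κ₂) 0 n ω
            * ∫⁻ x, likelihoodFactor κ₁ κ₂ n (past n ω) x * g (past n ω) x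
              ∂(κ₁ n (past n ω)) ∂P₁ :=
          lintegral_mul_condDistrib (hκ₁ n).2 (measurable_pastSigma_pathProd hy 0 n)
            (f := fun v x => likelihoodFactor κ₁ κ₂ n v x * g v x) ((hy n).mul hg)
      _ = ∫⁻ ω, pathProd (likelihoodFactor κ₁ κ₂) 0 n ω
            * ∫⁻ x, k (past n ω) x ∂(κ₂ n (past n ω)) ∂P₁ := by
          refine lintegral_congr fun ω => ?_
          congr 1
          exact kernel_lintegral_rnDeriv_mul (κ₂ n) (κ₁ n) (past n ω)
            (hg.comp measurable_prodMk_left)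
      _ = ∫⁻ ω, (regularPaths κ₁ κ₂ n).indicator 1 ω
            * ∫⁻ x, k (past n ω) x ∂(κ₂ n (past n ω)) ∂P₂ := by
          rw [ih (G := fun ω => ∫⁻ x, k (past n ω) x ∂(κ₂ n (past n ω)))
            (measurable_pastSigma_comp le_rfl hI)]
          refine lintegral_congr fun ω => ?_
          by_cases hω : ω ∈ regularPaths κ₁ κ₂ n <;> simp [hω]
      _ = ∫⁻ ω, (regularPaths κ₁ κ₂ n).indicator 1 ω * k (past n ω) (ω n) ∂P₂ :=
          (lintegral_mul_condDistrib (hκ₂ n).2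
            (measurable_pastSigma_indicator_one (measurableSet_regularPaths n))
            hkm).symm
      _ = ∫⁻ ω, (regularPaths κ₁ κ₂ (n + 1)).indicator G ω ∂P₂ := by
          refine lintegral_congr fun ω => ?_
          rw [regularPaths_succ]
          by_cases h1 : ω ∈ regularPaths κ₁ κ₂ n <;>
          by_cases h2 : ω n ∈ Kernel.mutuallySingularSetSlice (κ₂ n) (κ₁ n) (past n ω) <;>
          simp [h1, h2, hk, hgG]

theorem setLIntegral_pathProd_likelihoodFactor (hκ₁ : IsRegularConditionalSystem P₁ κ₁)
    (hκ₂ : IsRegularConditionalSystem P₂ κ₂) {n : ℕ} {A : Set (ℕ → Ω)}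
    (hA : MeasurableSet[pastSigma Ω n] A) :
    ∫⁻ ω in A, pathProd (likelihoodFactor κ₁ κ₂) 0 n ω ∂P₁ = P₂ (regularPaths κ₁ κ₂ n ∩ A) := by
  have hA' := pastSigma_le Ω n _ hA
  have hC := pastSigma_le Ω n _ (measurableSet_regularPaths (κ₁ := κ₁) (κ₂ := κ₂) n)
  have h := lintegral_pathProd_likelihoodFactor_mul hκ₁ hκ₂ n
    (measurable_pastSigma_indicator_one hA)
  rw [← lintegral_indicator_one (hC.inter hA'), ← lintegral_indicator hA', ← Set.indicator_indicator]
  rw [← h]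
  refine lintegral_congr fun ω => ?_
  by_cases hω : ω ∈ A <;> simp [hω]

/-- On regular paths P₂ gives {Y_n = 0} the mass ∫ Y_n dP₁ = 0 over that set; local absolute
continuity transfers this to P₁. -/
theorem ae_pathProd_likelihoodFactor_ne_zero (hκ₁ : IsRegularConditionalSystem P₁ κ₁)
    (hκ₂ : IsRegularConditionalSystem P₂ κ₂) (hloc : LocallyAbsolutelyContinuous P₁ P₂) :
    ∀ᵐ ω ∂P₁, ∀ n, pathProd (likelihoodFactor κ₁ κ₂) 0 n ω ≠ 0 := by
  have hmk₂ : ∀ n, IsMarkovKernel (κ₂ n) := fun n => (hκ₂ n).1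
  refine ae_all_iff.2 fun n => ?_
  set A := {ω | pathProd (likelihoodFactor κ₁ κ₂) 0 n ω = 0} with hAdef
  have hA : MeasurableSet[pastSigma Ω n] A :=
    measurable_pastSigma_pathProd measurable_likelihoodFactor 0 n (measurableSet_singleton 0)
  have hCA := (measurableSet_regularPaths (κ₁ := κ₁) (κ₂ := κ₂) n).inter hA
  have h2 : P₂ (regularPaths κ₁ κ₂ n ∩ A) = 0 := by
    rw [← setLIntegral_pathProd_likelihoodFactor hκ₁ hκ₂ hA,
      setLIntegral_congr_fun (pastSigma_le Ω n _ hA) (g := fun _ => 0) fun ω hω => hω]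
    simp
  have h1 : P₁ (regularPaths κ₁ κ₂ n ∩ A) = 0 := by
    rw [← trim_measurableSet_eq (pastSigma_le Ω n) hCA] at h2 ⊢
    exact hloc n h2
  filter_upwards [ae_mem_regularPaths (κ₂ := κ₂) hκ₁, measure_eq_zero_iff_ae_notMem.1 h1]
    with ω hω h hn using h ⟨hω n, hn⟩

/-- A zero conditional moment forces y_n, hence Y_{n+1}, to vanish almost surely on that event,
which the previous lemma excludes. -/
theorem ae_condMoment_likelihoodFactor_ne_zero (hκ₁ : IsRegularConditionalSystem P₁ κ₁)
    (hκ₂ : IsRegularConditionalSystem P₂ κ₂) (hloc : LocallyAbsolutelyContinuous P₁ P₂)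
    {s : ℝ} (hs : 0 < s) :
    ∀ᵐ ω ∂P₁, ∀ n, condMoment κ₁ (likelihoodFactor κ₁ κ₂) s n (past n ω) ≠ 0 := by
  have hmk : ∀ n, IsMarkovKernel (κ₁ n) := fun n => (hκ₁ n).1
  have hy : ∀ m, Measurable (Function.uncurry (likelihoodFactor κ₁ κ₂ m)) :=
    measurable_likelihoodFactor
  have h : ∀ n, ∀ᵐ ω ∂P₁, condMoment κ₁ (likelihoodFactor κ₁ κ₂) s n (past n ω) = 0 →
      likelihoodFactor κ₁ κ₂ n (past n ω) (ω n) = 0 := by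
    intro n
    set G : (ℕ → Ω) → ℝ≥0∞ :=
      {ω | condMoment κ₁ (likelihoodFactor κ₁ κ₂) s n (past n ω) = 0}.indicator 1
    have hG : Measurable[pastSigma Ω n] G :=
      measurable_pastSigma_indicator_one
        (measurable_pastSigma_comp le_rfl (measurable_condMoment hy s n) (measurableSet_singleton 0))
    have hf : Measurable (Function.uncurry fun v x => likelihoodFactor κ₁ κ₂ n v x ^ s) :=
      (hy n).pow_const s
    have h0 := lintegral_mul_condDistrib (hκ₁ n).2 hG hf
    have hz : ∀ ω,
        G ω * ∫⁻ x, likelihoodFactor κ₁ κ₂ n (past n ω) x ^ s ∂(κ₁ n (past n ω)) = 0 := by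
      intro ω
      by_cases hω : condMoment κ₁ (likelihoodFactor κ₁ κ₂) s n (past n ω) = 0
      · rw [condMoment] at hω
        simp [hω]
      · simp [G, hω]
    simp only [hz, lintegral_zero] at h0
    have hm : Measurable fun ω : ℕ → Ω => G ω * likelihoodFactor κ₁ κ₂ n (past n ω) (ω n) ^ s :=
      (hG.mono (pastSigma_le Ω n) le_rfl).mul
        (hf.comp ((measurable_past n).prodMk (measurable_pi_apply n)))
    rw [lintegral_eq_zero_iff hm] at h0
    filter_upwards [h0] with ω hω hc
    simpa [G, hc, hs, hs.not_gt] using hω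
  filter_upwards [ae_all_iff.2 h, ae_pathProd_likelihoodFactor_ne_zero hκ₁ hκ₂ hloc]
    with ω hω hne n hn
  refine hne (n + 1) ?_
  rw [pathProd_succ (Nat.zero_le n), hω n hn, mul_zero]

theorem measure_forall_exists_pathProd_likelihoodFactor_lt
    (hκ₁ : IsRegularConditionalSystem P₁ κ₁) (hκ₂ : IsRegularConditionalSystem P₂ κ₂) :
    P₂ {ω | (∀ n, ω ∈ regularPaths κ₁ κ₂ n) ∧
      ∀ δ : ℝ≥0∞, δ ≠ 0 → ∃ n, pathProd (likelihoodFactor κ₁ κ₂) 0 n ω < δ} = 0 := by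
  set Y := pathProd (likelihoodFactor κ₁ κ₂) 0
  set C := ⋂ n, regularPaths κ₁ κ₂ n
  have hδ : ∀ δ : ℝ≥0∞, P₂ (C ∩ ⋃ n, {ω | Y n ω < δ}) ≤ δ := by
    intro δ
    refine (measure_inter_iUnion_le_of_forall_pastSigma (μ := P₁) (δ := δ) (fun n => ?_)
      fun n A hA hAE => ?_).trans (mul_le_of_le_one_right' prob_le_one)
    · exact measurable_pastSigma_pathProd measurable_likelihoodFactor 0 n measurableSet_Iio
    · calc P₂ (C ∩ A) ≤ P₂ (regularPaths κ₁ κ₂ n ∩ A) :=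
            measure_mono (Set.inter_subset_inter_left _ (Set.iInter_subset _ n))
        _ = ∫⁻ ω in A, Y n ω ∂P₁ := (setLIntegral_pathProd_likelihoodFactor hκ₁ hκ₂ hA).symm
        _ ≤ ∫⁻ _ in A, δ ∂P₁ := setLIntegral_mono measurable_const fun ω hω => (hAE hω).le
        _ = δ * P₁ A := setLIntegral_const _ _
  have h2 : P₂ (⋂ j : ℕ, C ∩ ⋃ n, {ω | Y n ω < (j : ℝ≥0∞)⁻¹}) = 0 :=
    le_antisymm (ge_of_tendsto' ENNReal.tendsto_inv_nat_nhds_zero fun j =>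
      (measure_mono (Set.iInter_subset _ j)).trans (hδ _)) zero_le
  refine measure_mono_null (fun ω hω => Set.mem_iInter.2 fun j => ?_) h2
  exact ⟨Set.mem_iInter.2 hω.1, Set.mem_iUnion.2 (hω.2 _ (by simp))⟩

/-- Where Y_n > c, the measure P₁ is at most c⁻¹ P₂ on events of the n-th past. Hence P₁ cannot
charge a P₂-null set on which Y_n exceeds c infinitely often. -/
theorem measure_inter_not_tendsto_likelihood_eq_zero (hκ₁ : IsRegularConditionalSystem P₁ κ₁)
    (hκ₂ : IsRegularConditionalSystem P₂ κ₂) {N : Set (ℕ → Ω)} (hN : P₂ N = 0) :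
    P₁ (N ∩ {ω | ¬ Tendsto (fun n => pathProd (likelihoodFactor κ₁ κ₂) 0 n ω)
      atTop (nhds 0)}) = 0 := by
  wlog hNm : MeasurableSet N generalizing N
  · exact measure_mono_null (Set.inter_subset_inter_left _ (subset_toMeasurable P₂ N))
      (this (by rwa [measure_toMeasurable]) (measurableSet_toMeasurable _ _))
  set Y := pathProd (likelihoodFactor κ₁ κ₂) 0
  have hY : ∀ n, Measurable[pastSigma Ω n] (Y n) :=
    measurable_pastSigma_pathProd measurable_likelihoodFactor 0
  have hc : ∀ c : ℝ≥0∞, c ≠ 0 → c ≠ ⊤ → P₁ (N ∩ {ω | ∃ᶠ n in atTop, c < Y n ω}) = 0 := by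
    intro c hc0 hctop
    have key : ∀ η : ℝ≥0∞, 0 < η →
        P₁ (N ∩ {ω | ∃ᶠ n in atTop, c < Y n ω}) ≤ η + c⁻¹ * η := by
      intro η hη
      -- Closeness is needed for both measures: P₁ to control the part of N outside A, P₂ to make A
      -- itself P₂-small.
      obtain ⟨m, A, hA, hAN⟩ := exists_pastSigma_measure_symmDiff_lt (P₁ + P₂) hNm hη
      rw [Measure.add_apply] at hAN
      set E : ℕ → Set (ℕ → Ω) := fun n => {ω | m ≤ n ∧ ω ∈ A ∧ c < Y n ω} with hE
      have hEm : ∀ n, MeasurableSet[pastSigma Ω n] (E n) := by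
        intro n
        by_cases hmn : m ≤ n
        · simp only [hE, hmn, true_and]
          exact (pastSigma_mono hmn _ hA).inter (hY n measurableSet_Ioi)
        · simp [hE, hmn]
      have hmax : P₁ (⋃ n, E n) ≤ c⁻¹ * P₂ (⋃ n, E n) := by
        have := measure_inter_iUnion_le_of_forall_pastSigma (μ := P₂) (ν := P₁)
          (C := Set.univ) (δ := c⁻¹) hEm fun n B hB hBE => ?_
        · simpa using this
        · rw [Set.univ_inter, ← ENNReal.mul_le_iff_le_inv hc0 hctop]
          calc c * P₁ B = ∫⁻ _ in B, c ∂P₁ := (setLIntegral_const _ _).symm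
            _ ≤ ∫⁻ ω in B, Y n ω ∂P₁ :=
              setLIntegral_mono ((hY n).mono (pastSigma_le Ω n) le_rfl) fun ω hω => (hBE hω).2.2.le
            _ = P₂ (regularPaths κ₁ κ₂ n ∩ B) :=
              setLIntegral_pathProd_likelihoodFactor hκ₁ hκ₂ hB
            _ ≤ P₂ B := measure_mono Set.inter_subset_right
      have hEA : P₂ (⋃ n, E n) ≤ η := by
        have hsub : (⋃ n, E n) ⊆ N ∪ symmDiff A N := by
          intro ω hω
          obtain ⟨n, -, hωA, -⟩ := Set.mem_iUnion.1 hω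
          by_cases h : ω ∈ N
          · exact Or.inl h
          · exact Or.inr (Or.inl ⟨hωA, h⟩)
        refine (measure_mono hsub).trans ((measure_union_le _ _).trans ?_)
        rw [hN, zero_add]
        exact le_add_self.trans hAN.le
      have hsub : N ∩ {ω | ∃ᶠ n in atTop, c < Y n ω} ⊆ symmDiff A N ∪ ⋃ n, E n := by
        rintro ω ⟨hωN, hω⟩
        by_cases h : ω ∈ A
        · obtain ⟨n, hn, hmn⟩ := (hω.and_eventually (eventually_ge_atTop m)).exists
          exact Or.inr (Set.mem_iUnion.2 ⟨n, hmn, h, hn⟩)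
        · exact Or.inl (Or.inr ⟨hωN, h⟩)
      refine (measure_mono hsub).trans ((measure_union_le _ _).trans (add_le_add ?_ ?_))
      · exact le_self_add.trans hAN.le
      · exact hmax.trans (by gcongr)
    have hlim : Tendsto (fun n : ℕ => (n : ℝ≥0∞)⁻¹ + c⁻¹ * (n : ℝ≥0∞)⁻¹) atTop (nhds 0) := by
      simpa using ENNReal.tendsto_inv_nat_nhds_zero.add (ENNReal.Tendsto.const_mul
        ENNReal.tendsto_inv_nat_nhds_zero (Or.inr (ENNReal.inv_ne_top.2 hc0)))
    exact le_antisymm (ge_of_tendsto' hlim fun n => key _ (by simp)) zero_le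
  -- The shift to j + 1 keeps the thresholds finite.
  refine measure_mono_null ?_ (measure_iUnion_null fun j : ℕ =>
    hc ((j + 1 : ℕ) : ℝ≥0∞)⁻¹ (by simp) (by simp))
  rintro ω ⟨hωN, hω⟩
  by_contra hcon
  refine hω (ENNReal.tendsto_nhds_zero.2 fun δ hδ => ?_)
  obtain ⟨j, hj⟩ := ENNReal.exists_inv_nat_lt hδ.ne'
  have hnot : ¬ ∃ᶠ n in atTop, ((j + 1 : ℕ) : ℝ≥0∞)⁻¹ < Y n ω := fun h =>
    hcon (Set.mem_iUnion.2 ⟨j, hωN, h⟩)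
  filter_upwards [not_frequently.1 hnot] with n hn
  refine (not_lt.1 hn).trans (le_trans ?_ hj.le)
  exact ENNReal.inv_le_inv.2 (by exact_mod_cast Nat.le_succ j)

theorem condMoment_likelihoodFactor [∀ n, IsMarkovKernel (κ₁ n)] [∀ n, IsMarkovKernel (κ₂ n)]
    (s : ℝ) (n : ℕ) (v : Fin n → Ω) :
    condMoment κ₁ (likelihoodFactor κ₁ κ₂) s n v
      = ∫⁻ x, ((κ₂ n v).rnDeriv (κ₁ n v) x) ^ s ∂(κ₁ n v) := by
  refine lintegral_congr_ae ?_
  filter_upwards [Kernel.rnDeriv_eq_rnDeriv_measure (κ := κ₂ n) (η := κ₁ n) (a := v)] with x hx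
  rw [likelihoodFactor, hx]

/-- The two conclusions are not formal negations of each other; each is exactly what one of the two
null-set lemmas above can contradict. -/
theorem ae_alphaDivergence_dichotomy (hκ₁ : IsRegularConditionalSystem P₁ κ₁)
    (hκ₂ : IsRegularConditionalSystem P₂ κ₂) (hloc : LocallyAbsolutelyContinuous P₁ P₂)
    {α : ℝ} (hα : α ∈ Set.Ioo (-1 : ℝ) 1) :
    ∀ᵐ ω ∂P₁,
      ((Summable fun n => alphaDivergence α (κ₁ n (past n ω)) (κ₂ n (past n ω))) →
        ¬ Tendsto (fun n => pathProd (likelihoodFactor κ₁ κ₂) 0 n ω) atTop (nhds 0)) ∧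
      ((¬ Summable fun n => alphaDivergence α (κ₁ n (past n ω)) (κ₂ n (past n ω))) →
        ∀ δ : ℝ≥0∞, δ ≠ 0 → ∃ n, pathProd (likelihoodFactor κ₁ κ₂) 0 n ω < δ) := by
  have hmk₁ : ∀ n, IsMarkovKernel (κ₁ n) := fun n => (hκ₁ n).1
  have hmk₂ : ∀ n, IsMarkovKernel (κ₂ n) := fun n => (hκ₂ n).1
  set s := (1 + α) / 2 with hs_def
  have hs : s ∈ Set.Ioo (0 : ℝ) 1 := ⟨by linarith [hα.1], by linarith [hα.2]⟩
  have hy : ∀ m, Measurable (Function.uncurry (likelihoodFactor κ₁ κ₂ m)) :=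
    measurable_likelihoodFactor
  have hy1 : ∀ n v, ∫⁻ x, likelihoodFactor κ₁ κ₂ n v x ∂(κ₁ n v) ≤ 1 :=
    lintegral_likelihoodFactor_le
  set H := condMoment κ₁ (likelihoodFactor κ₁ κ₂) s
  have hH1 : ∀ n v, H n v ≤ 1 := condMoment_le_one hy hy1 hs
  have hK : (4 / (1 - α ^ 2) : ℝ) ≠ 0 := by
    have : 0 < 1 - α ^ 2 := by nlinarith [hα.1, hα.2]
    positivity
  have hsum : ∀ ω : ℕ → Ω,
      (Summable fun n => alphaDivergence α (κ₁ n (past n ω)) (κ₂ n (past n ω))) ↔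
        Summable fun n => 1 - (H n (past n ω)).toReal := by
    intro ω
    have : ∀ n, alphaDivergence α (κ₁ n (past n ω)) (κ₂ n (past n ω))
        = 4 / (1 - α ^ 2) * (1 - (H n (past n ω)).toReal) := fun n => by
      rw [alphaDivergence_eq _ _ hα, ← hs_def, ← condMoment_likelihoodFactor]
    simp only [this]
    exact summable_mul_left_iff hK
  -- Countably many lower bounds 1/(j + 1) ≤ 1 suffice, since the bound ε found later depends on the
  -- path.
  have hlow : ∀ j : ℕ, ∀ᵐ ω ∂P₁,
      ¬ ((∀ n, ((j + 1 : ℕ) : ℝ≥0∞)⁻¹ ≤ ∏ k ∈ Finset.range n, H k (past k ω)) ∧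
        (∀ n, pathProd (likelihoodFactor κ₁ κ₂) 0 n ω ≠ 0) ∧
        Tendsto (fun n => pathProd (likelihoodFactor κ₁ κ₂) 0 n ω) atTop (nhds 0)) := fun j =>
    measure_eq_zero_iff_ae_notMem.1 (measure_tendsto_pathProd_zero_of_le_prod hκ₁ hy hy1 hs
      (ENNReal.inv_ne_zero.2 (ENNReal.natCast_ne_top _))
      (ENNReal.inv_le_one.2 (by exact_mod_cast Nat.succ_pos j)))
  filter_upwards [ae_all_iff.2 hlow, ae_exists_pathProd_lt hκ₁ hy hy1 hs,
    ae_condMoment_likelihoodFactor_ne_zero hκ₁ hκ₂ hloc hs.1,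
    ae_pathProd_likelihoodFactor_ne_zero hκ₁ hκ₂ hloc] with ω hω₁ hω₂ hH0 hY0
  rw [hsum]
  refine ⟨fun h ht => ?_, fun h => ?_⟩
  · obtain ⟨ε, hε, hle⟩ := exists_le_prod_of_summable (fun n => hH1 n _) hH0 h
    obtain ⟨j, hj⟩ := ENNReal.exists_inv_nat_lt hε
    refine hω₁ j ⟨fun n => ?_, hY0, ht⟩
    refine (ENNReal.inv_le_inv.2 ?_).trans (hj.le.trans (hle n))
    exact_mod_cast Nat.le_succ j
  · exact hω₂ hH0 (tendsto_prod_zero_of_not_summable (fun n => hH1 n _) h)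

theorem alphaDivergence_nonneg {γ : Type*} [MeasurableSpace γ] (μ ν : Measure γ)
    [IsProbabilityMeasure μ] [IsProbabilityMeasure ν] {α : ℝ} (hα : α ∈ Set.Ioo (-1 : ℝ) 1) :
    0 ≤ alphaDivergence α μ ν := by
  have hs : (1 + α) / 2 ∈ Set.Ioo (0 : ℝ) 1 := ⟨by linarith [hα.1], by linarith [hα.2]⟩
  have hpos : 0 < 1 - α ^ 2 := by nlinarith [hα.1, hα.2]
  rw [alphaDivergence_eq μ ν hα]
  have h := setLIntegral_rpow_le (Measure.measurable_rnDeriv ν μ)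
    (by simpa using Measure.lintegral_rnDeriv_le (μ := ν) (ν := μ)) hs Set.univ
  rw [Measure.restrict_univ, measure_univ, ENNReal.one_rpow] at h
  have := ENNReal.toReal_mono ENNReal.one_ne_top h
  rw [ENNReal.toReal_one] at this
  exact mul_nonneg (by positivity) (sub_nonneg.2 this)

end Comparison

/-! ### Absolute continuity and singularity from the dichotomy. -/

theorem mainTheorem6 {Ω : Type*} [MeasurableSpace Ω] [MeasurableSpace.CountablyGenerated Ω]
    (P₁ P₂ : Measure (ℕ → Ω)) [IsProbabilityMeasure P₁] [IsProbabilityMeasure P₂]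
    (κ₁ κ₂ : (n : ℕ) → Kernel (Fin n → Ω) Ω)
    (hκ₁ : IsRegularConditionalSystem P₁ κ₁) (hκ₂ : IsRegularConditionalSystem P₂ κ₂)
    (hloc : LocallyAbsolutelyContinuous P₁ P₂)
    (α : ℝ) (hα : α ∈ Set.Ioo (-1 : ℝ) 1) :
    (P₁ ≪ P₂ ↔
      ∀ᵐ ω ∂P₁, Summable fun n => alphaDivergence α (κ₁ n (past n ω)) (κ₂ n (past n ω))) ∧
    (P₁ ⟂ₘ P₂ ↔
      ∀ᵐ ω ∂P₁, Tendsto (fun N => ∑ n ∈ Finset.range N,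
        alphaDivergence α (κ₁ n (past n ω)) (κ₂ n (past n ω))) atTop atTop) := by
  have hmk₁ : ∀ n, IsMarkovKernel (κ₁ n) := fun n => (hκ₁ n).1
  have hmk₂ : ∀ n, IsMarkovKernel (κ₂ n) := fun n => (hκ₂ n).1
  have hdich := ae_alphaDivergence_dichotomy hκ₁ hκ₂ hloc hα
  have hdiv : ∀ ω : ℕ → Ω, Tendsto (fun N => ∑ n ∈ Finset.range N,
      alphaDivergence α (κ₁ n (past n ω)) (κ₂ n (past n ω))) atTop atTop ↔
      ¬ Summable fun n => alphaDivergence α (κ₁ n (past n ω)) (κ₂ n (past n ω)) := fun ω =>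
    (not_summable_iff_tendsto_nat_atTop_of_nonneg fun n => alphaDivergence_nonneg _ _ hα).symm
  have hreg := ae_mem_regularPaths (κ₂ := κ₂) hκ₁
  have hnull := measure_forall_exists_pathProd_likelihoodFactor_lt hκ₁ hκ₂
  simp only [hdiv]
  refine ⟨⟨fun hac => ?_, fun h => Measure.AbsolutelyContinuous.mk fun N _ hN => ?_⟩,
    fun hsing => ?_, fun h => ?_⟩
  · filter_upwards [hdich, measure_eq_zero_iff_ae_notMem.1 (hac hnull), hreg] with ω hω hn hC
    by_contra hns
    exact hn ⟨hC, hω.2 hns⟩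
  · have h0 := measure_inter_not_tendsto_likelihood_eq_zero hκ₁ hκ₂ hN
    rw [measure_eq_zero_iff_ae_notMem] at h0 ⊢
    filter_upwards [hdich, h, h0] with ω hω hs hω0 hωN using hω0 ⟨hωN, hω.1 hs⟩
  · obtain ⟨S, -, hS₁, hS₂⟩ := hsing
    have h0 := measure_inter_not_tendsto_likelihood_eq_zero hκ₁ hκ₂ hS₂
    rw [measure_eq_zero_iff_ae_notMem] at h0 hS₁
    filter_upwards [hdich, h0, hS₁] with ω hω hω0 hωS hs using hω0 ⟨hωS, hω.1 hs⟩
  -- The separating set is that of the regular paths with inf Y_n = 0: it is P₂-null and, by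
  -- divergence, carries all of P₁.
  · refine .mk (measure_eq_zero_iff_ae_notMem.2 ?_) hnull
      fun ω _ => (em _).symm
    filter_upwards [hdich, hreg, h] with ω hω hC hs hn using hn ⟨hC, hω.2 hs⟩
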